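/- All matroids are finite. For a matroid $M$ with ground set $E(M)$ and rank function $r_M$, let $\lambda_M(X) = r_M(X) + r_M(E(M)\setminus X) - r_M(E(M))$ for $X\subseteq E(M)$. A partition $(X,Y)$ of $E(M)$ is a $k$-separation of $M$ if $|X|,|Y|\ge k$ and $\lambda_M(X)<k$, and $M$ is $3$-connected if it has no $k'$-separation with $k'<3$. A tangle of $M$ of order $\theta$ is a collection $\mathcal T$ of subsets of $E(M)$ such that: (i) $\lambda_M(X)<\theta$ for all $X\in\mathcal T$; (ii) for each $X\subseteq E(M)$ with $\lambda_M(X)<\theta$, $X\in\mathcal T$ or $E(M)\setminus X\in\mathcal T$; (iii) $X\cup Y\cup Z\ne E(M)$ for all $X,Y,Z\in\mathcal T$; (iv) $E(M)\setminus\{e\}\notin\mathcal T$ for each $e\in E(M)$. The tangle matroid $M(\mathcal T)$ is the matroid on $E(M)$ whose rank function $r_{\mathcal T}$ is given by $r_{\mathcal T}(X)=\min\{\lambda_M(Y) : X\subseteq Y\in\mathcal T\}$ if some member of $\mathcal T$ contains $X$, and $r_{\mathcal T}(X)=\theta$ otherwise. A long line of a matroid is a closed set of rank two with at least three elements. A triangle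 of $M$ is a $3$-element circuit, and a triad of $M$ is a $3$-element circuit of the dual $M^*$. A fan of $M$ of length $k\ge 3$ is a sequence $(x_1,\dots,x_k)$ of distinct elements of $E(M)$ such that $\{x_1,x_2,x_3\}$ is a triangle or a triad and, for each $i\in\{1,\dots,k-3\}$, if $\{x_i,x_{i+1},x_{i+2}\}$ is a triangle then $\{x_{i+1},x_{i+2},x_{i+3}\}$ is a triad, and if $\{x_i,x_{i+1},x_{i+2}\}$ is a triad then $\{x_{i+1},x_{i+2},x_{i+3}\}$ is a triangle. A fan of $M$ is maximal if its set of elements is not properly contained in the set of elements of another fan of $M$. Let $M$ be a $3$-connected matroid, let $\mathcal T$ be a tangle of $M$, let $N$ be a minor of $M$, and let $X_1,\dots,X_r$ be long lines of $M(\mathcal T)$ with $r_{\mathcal T}(X_1\cup\dots\cup X_r)=2r$. Suppose that the following hold for all $i\in\{1,\dots,r\}$: 1. $X_i\cap E(N)=\emptyset$; 2. $X_i$ contains (all elements of) a maximal fan $F_i$ of $M$ of length at least four; 3. $e_i$ is an element of $F_i$ such that $M\backslash e_i$ is $3$-connected with $N$ as a minor. Then $M\backslash\{e_1,\dots,e_r\}$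 is $3$-connected with $N$ as a minor. -/

import Mathlib

open scoped Matroid

namespace Matroid

variable {α : Type*}

noncomputable section

/-- The rank `r_M(X)` as a natural number. It is only used for finite matroids, where the
`ℕ∞`-valued rank is finite. -/
def natRk (M : Matroid α) (X : Set α) : ℕ := (M.eRk X).toNat

/-- The connectivity function `λ_M(X) = r_M(X) + r_M(E(M) \ X) - r(M)`. The subtraction
does not truncate, see `natRk_ground_le`. -/
def conn (M : Matroid α) (X : Set α) : ℕ := M.natRk X + M.natRk (M.E \ X) - M.natRk M.E

/-- `(X, Y)` is a `k`-separation of `M`. -/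
structure IsKSeparation (M : Matroid α) (k : ℕ) (X Y : Set α) : Prop where
  union_eq : X ∪ Y = M.E
  disjoint : Disjoint X Y
  le_left : (k : ℕ∞) ≤ X.encard
  le_right : (k : ℕ∞) ≤ Y.encard
  conn_lt : M.conn X < k

/-- `M` is `k`-connected if it has no `k'`-separation with `k' < k`. -/
def IsKConnected (M : Matroid α) (k : ℕ) : Prop :=
  ∀ k' < k, ∀ X Y : Set α, ¬ M.IsKSeparation k' X Y

/-- A triangle of `M`: a set `T` with `M|T ≅ U_{2,3}`, that is, a 3-element circuit. -/
def IsTriangle (M : Matroid α) (T : Set α) : Prop := M.IsCircuit T ∧ T.encard = 3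

/-- A triad of `M` is a triangle of the dual of `M`. -/
def IsTriad (M : Matroid α) (T : Set α) : Prop := M✶.IsTriangle T

/-- The ordered set `F = (x_1, ..., x_k)` is a fan of `M` (indices are shifted to start at 0). -/
structure IsFan (M : Matroid α) (F : List α) : Prop where
  three_le : 3 ≤ F.length
  nodup : F.Nodup
  subset_ground : ∀ x ∈ F, x ∈ M.E
  start : M.IsTriangle {F[0], F[1], F[2]} ∨ M.IsTriad {F[0], F[1], F[2]}
  triad_of_triangle : ∀ (i : ℕ) (_ : i + 3 < F.length),
    M.IsTriangle {F[i], F[i + 1], F[i + 2]} → M.IsTriad {F[i + 1], F[i + 2], F[i + 3]}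
  triangle_of_triad : ∀ (i : ℕ) (_ : i + 3 < F.length),
    M.IsTriad {F[i], F[i + 1], F[i + 2]} → M.IsTriangle {F[i + 1], F[i + 2], F[i + 3]}

/-- `F` is an inclusionwise maximal fan of `M`: its set of elements is not properly contained
in the set of elements of another fan of `M`. -/
def IsMaximalFan (M : Matroid α) (F : List α) : Prop :=
  M.IsFan F ∧ ∀ F' : List α, M.IsFan F' → F ⊆ F' → F' ⊆ F

/-- A line of `M` is a closed set of rank two; it is long if it has at least three elements. -/
structure IsLongLine (M : Matroid α) (X : Set α) : Prop where
  isFlat : M.IsFlat X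
  rank_eq : M.eRk X = 2
  three_le : 3 ≤ X.encard

/-- `T` is a tangle of order `θ` of `M`. -/
structure IsTangle (M : Matroid α) (T : Set (Set α)) (θ : ℕ) : Prop where
  subset_ground : ∀ X ∈ T, X ⊆ M.E
  conn_lt : ∀ X ∈ T, M.conn X < θ
  mem_or_compl_mem : ∀ X ⊆ M.E, M.conn X < θ → X ∈ T ∨ M.E \ X ∈ T
  union_ne : ∀ X ∈ T, ∀ Y ∈ T, ∀ Z ∈ T, X ∪ Y ∪ Z ≠ M.E
  compl_singleton_notMem : ∀ e ∈ M.E, M.E \ {e} ∉ T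

open Classical in
/-- The rank function of the tangle matroid: the minimum of `λ_M(Y)` over all `Y ∈ T` that
contain `X` if there is such a `Y`, and `θ` otherwise. -/
def tangleRk (M : Matroid α) (T : Set (Set α)) (θ : ℕ) (X : Set α) : ℕ :=
  if ∃ Y ∈ T, X ⊆ Y then sInf {n | ∃ Y ∈ T, X ⊆ Y ∧ M.conn Y = n} else θ

section RankFunction

variable {E : Set α} {f : Set α → ℕ}

lemma rankFun_union_le (hE : E.Finite)
    (h_insert : ∀ X ⊆ E, ∀ e ∈ E, f (insert e X) ≤ f X + 1)
    {X Y : Set α} (hX : X ⊆ E) (hY : Y ⊆ E) : f (X ∪ Y) ≤ f X + Y.ncard := by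
  induction Y, hE.subset hY using Set.Finite.induction_on with
  | empty => simp
  | @insert a Y ha hYf ih =>
    obtain ⟨haE, hYE⟩ := Set.insert_subset_iff.1 hY
    rw [Set.union_insert, Set.ncard_insert_of_notMem ha hYf]
    have := h_insert (X ∪ Y) (Set.union_subset hX hYE) a haE
    have := ih hYE
    omega

lemma rankFun_union_eq (hE : E.Finite)
    (h_mono : ∀ X Y, X ⊆ Y → Y ⊆ E → f X ≤ f Y)
    (h_submod : ∀ X ⊆ E, ∀ Y ⊆ E, f (X ∩ Y) + f (X ∪ Y) ≤ f X + f Y)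
    {X Y : Set α} (hX : X ⊆ E) (hY : Y ⊆ E) (h : ∀ e ∈ Y, f (insert e X) = f X) :
    f (X ∪ Y) = f X := by
  induction Y, hE.subset hY using Set.Finite.induction_on with
  | empty => simp
  | @insert a Y ha hYf ih =>
    obtain ⟨haE, hYE⟩ := Set.insert_subset_iff.1 hY
    have h1 := ih hYE fun e he => h e (Set.mem_insert_of_mem _ he)
    have h2 := h a (Set.mem_insert _ _)
    have h3 := h_submod (X ∪ Y) (Set.union_subset hX hYE) (insert a X)
      (Set.insert_subset haE hX)
    have h4 : f X ≤ f ((X ∪ Y) ∩ insert a X) :=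
      h_mono _ _ (Set.subset_inter Set.subset_union_left (Set.subset_insert _ _))
        (Set.inter_subset_left.trans (Set.union_subset hX hYE))
    have h5 : (X ∪ Y) ∪ insert a X = X ∪ insert a Y := by
      ext x; simp only [Set.mem_union, Set.mem_insert_iff]; tauto
    have h6 : f X ≤ f (X ∪ insert a Y) :=
      h_mono _ _ Set.subset_union_left (Set.union_subset hX hY)
    rw [h5] at h3
    omega

/-- The matroid on a finite set `E` with a given rank function. -/
def ofRankFun (hE : E.Finite) (f : Set α → ℕ) (h_empty : f ∅ = 0)
    (h_mono : ∀ X Y, X ⊆ Y → Y ⊆ E → f X ≤ f Y)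
    (h_insert : ∀ X ⊆ E, ∀ e ∈ E, f (insert e X) ≤ f X + 1)
    (h_submod : ∀ X ⊆ E, ∀ Y ⊆ E, f (X ∩ Y) + f (X ∪ Y) ≤ f X + f Y) : Matroid α :=
  (IndepMatroid.ofFinite hE (fun I => I ⊆ E ∧ f I = I.ncard)
    ⟨Set.empty_subset _, by simpa using h_empty⟩
    (by
      rintro I J ⟨hJE, hJ⟩ hIJ
      refine ⟨hIJ.trans hJE, ?_⟩
      have h1 := rankFun_union_le hE h_insert (hIJ.trans hJE)
        ((Set.sdiff_subset (t := I)).trans hJE)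
      have h2 := rankFun_union_le hE h_insert (Set.empty_subset E) (hIJ.trans hJE)
      rw [Set.union_sdiff_cancel hIJ] at h1
      rw [Set.empty_union, h_empty] at h2
      have h3 := Set.ncard_sdiff_add_ncard_of_subset hIJ (hE.subset hJE)
      omega)
    (by
      rintro I J ⟨hIE, hI⟩ ⟨hJE, hJ⟩ hlt
      by_contra! hcon
      have h1 : f (I ∪ J) = f I := by
        refine rankFun_union_eq hE h_mono h_submod hIE hJE fun e he => ?_
        by_cases heI : e ∈ I
        · rw [Set.insert_eq_of_mem heI]
        have h2 := hcon e he heI (Set.insert_subset (hJE he) hIE)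
        rw [Set.ncard_insert_of_notMem heI (hE.subset hIE)] at h2
        have h3 := h_insert I hIE e (hJE he)
        have h4 := h_mono I (insert e I) (Set.subset_insert _ _)
          (Set.insert_subset (hJE he) hIE)
        omega
      have h2 := h_mono J (I ∪ J) Set.subset_union_right (Set.union_subset hIE hJE)
      omega)
    (fun _ h => h.1)).matroid

lemma eRk_ofRankFun (hE : E.Finite) (h_empty : f ∅ = 0)
    (h_mono : ∀ X Y, X ⊆ Y → Y ⊆ E → f X ≤ f Y)
    (h_insert : ∀ X ⊆ E, ∀ e ∈ E, f (insert e X) ≤ f X + 1)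
    (h_submod : ∀ X ⊆ E, ∀ Y ⊆ E, f (X ∩ Y) + f (X ∪ Y) ≤ f X + f Y)
    {X : Set α} (hX : X ⊆ E) :
    (ofRankFun hE f h_empty h_mono h_insert h_submod).eRk X = f X := by
  set M := ofRankFun hE f h_empty h_mono h_insert h_submod with hM
  have h_ind : ∀ I, M.Indep I ↔ I ⊆ E ∧ f I = I.ncard := fun I => Iff.rfl
  obtain ⟨I, hI⟩ := M.exists_isBasis' X
  obtain ⟨hIE, hIc⟩ := (h_ind I).1 hI.indep
  have h1 : f (I ∪ X) = f I := by
    refine rankFun_union_eq hE h_mono h_submod hIE hX fun e he => ?_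
    by_cases heI : e ∈ I
    · rw [Set.insert_eq_of_mem heI]
    have h2 : ¬ M.Indep (insert e I) := fun h =>
      heI (hI.mem_of_insert_indep he h)
    rw [h_ind, Set.ncard_insert_of_notMem heI (hE.subset hIE)] at h2
    have h3 := h_insert I hIE e (hX he)
    have h4 := h_mono I (insert e I) (Set.subset_insert _ _)
      (Set.insert_subset (hX he) hIE)
    have h5 : f (insert e I) ≠ I.ncard + 1 := fun h =>
      h2 ⟨Set.insert_subset (hX he) hIE, h⟩
    omega
  rw [Set.union_eq_self_of_subset_left hI.subset] at h1
  rw [← hI.encard_eq_eRk, h1, hIc, (hE.subset hIE).cast_ncard_eq]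

end RankFunction

lemma conn_empty (M : Matroid α) : M.conn ∅ = 0 := by
  simp [conn, natRk]

section Conn

variable (M : Matroid α) [M.Finite]

lemma cast_natRk (X : Set α) : (M.natRk X : ℕ∞) = M.eRk X :=
  ENat.natCast_toNat (M.eRk_ne_top_iff.2 (RankFinite.isRkFinite X))

lemma natRk_ground_le (X : Set α) : M.natRk M.E ≤ M.natRk X + M.natRk (M.E \ X) := by
  have := M.eRk_le_eRk_inter_add_eRk_sdiff M.E X
  rw [eRk_ground_inter, ← cast_natRk, ← cast_natRk, ← cast_natRk] at this
  exact_mod_cast this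

lemma natRk_submod (X Y : Set α) :
    M.natRk (X ∩ Y) + M.natRk (X ∪ Y) ≤ M.natRk X + M.natRk Y := by
  have := M.eRk_inter_add_eRk_union_le X Y
  simp only [← cast_natRk] at this
  exact_mod_cast this

lemma conn_submod (X Y : Set α) :
    M.conn (X ∩ Y) + M.conn (X ∪ Y) ≤ M.conn X + M.conn Y := by
  have h1 := M.natRk_submod X Y
  have h2 := M.natRk_submod (M.E \ X) (M.E \ Y)
  rw [← Set.sdiff_inter, Set.sdiff_inter_sdiff] at h2
  have h3 := M.natRk_ground_le X
  have h4 := M.natRk_ground_le Y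
  have h5 := M.natRk_ground_le (X ∩ Y)
  have h6 := M.natRk_ground_le (X ∪ Y)
  unfold conn
  omega

lemma conn_singleton_le (e : α) : M.conn {e} ≤ 1 := by
  have h1 : M.natRk {e} ≤ 1 := by
    have := M.eRk_singleton_le e
    rw [← cast_natRk] at this
    exact_mod_cast this
  have h2 : M.natRk (M.E \ {e}) ≤ M.natRk M.E := by
    have := M.eRk_mono (Set.sdiff_subset (s := M.E) (t := {e}))
    rw [← cast_natRk, ← cast_natRk] at this
    exact_mod_cast this
  unfold conn
  omega

end Conn

section TangleMatroid

variable {M : Matroid α} {T : Set (Set α)} {θ : ℕ}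

lemma tangleRk_le_conn {X Y : Set α} (hY : Y ∈ T) (hXY : X ⊆ Y) :
    M.tangleRk T θ X ≤ M.conn Y := by
  rw [tangleRk, if_pos ⟨Y, hY, hXY⟩]
  exact Nat.sInf_le ⟨Y, hY, hXY, rfl⟩

lemma tangleRk_eq_or (X : Set α) : M.tangleRk T θ X = θ ∨
    ∃ Y ∈ T, X ⊆ Y ∧ M.conn Y = M.tangleRk T θ X := by
  by_cases h : ∃ Y ∈ T, X ⊆ Y
  · right
    rw [tangleRk, if_pos h]
    obtain ⟨Y, hY, hXY⟩ := h
    exact Nat.sInf_mem (s := {n | ∃ Y ∈ T, X ⊆ Y ∧ M.conn Y = n}) ⟨_, Y, hY, hXY, rfl⟩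
  · left
    rw [tangleRk, if_neg h]

lemma IsTangle.tangleRk_le (hT : M.IsTangle T θ) (X : Set α) : M.tangleRk T θ X ≤ θ := by
  obtain h | ⟨Y, hY, -, h⟩ := tangleRk_eq_or (M := M) (T := T) (θ := θ) X
  · exact h.le
  · exact h ▸ (hT.conn_lt Y hY).le

lemma IsTangle.tangleRk_mono (hT : M.IsTangle T θ) {X X' : Set α} (h : X ⊆ X') :
    M.tangleRk T θ X ≤ M.tangleRk T θ X' := by
  obtain h' | ⟨Y, hY, hXY, h'⟩ := tangleRk_eq_or (M := M) (T := T) (θ := θ) X'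
  · exact (hT.tangleRk_le X).trans h'.ge
  · exact h' ▸ tangleRk_le_conn hY (h.trans hXY)

lemma IsTangle.tangleRk_le_conn_of_subset_union (hT : M.IsTangle T θ) {X Y Y₁ Y₂ : Set α}
    (hXY : X ⊆ Y) (h₁ : Y₁ ∈ T) (h₂ : Y₂ ∈ T) (hY : Y ⊆ Y₁ ∪ Y₂) :
    M.tangleRk T θ X ≤ M.conn Y := by
  have hYE : Y ⊆ M.E :=
    hY.trans (Set.union_subset (hT.subset_ground _ h₁) (hT.subset_ground _ h₂))
  obtain hlt | hle := lt_or_ge (M.conn Y) θ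
  · obtain h | h := hT.mem_or_compl_mem Y hYE hlt
    · exact tangleRk_le_conn h hXY
    · refine absurd ?_ (hT.union_ne _ h₁ _ h₂ _ h)
      refine subset_antisymm (Set.union_subset (Set.union_subset (hT.subset_ground _ h₁)
        (hT.subset_ground _ h₂)) Set.sdiff_subset) fun x hx => ?_
      by_cases hxY : x ∈ Y
      · exact Or.inl (hY hxY)
      · exact Or.inr ⟨hx, hxY⟩
  · exact (hT.tangleRk_le X).trans hle

lemma IsTangle.tangleRk_empty (hT : M.IsTangle T θ) : M.tangleRk T θ ∅ = 0 := by
  obtain rfl | hpos := Nat.eq_zero_or_pos θ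
  · exact Nat.le_zero.1 (hT.tangleRk_le ∅)
  have h0 := M.conn_empty
  obtain h | h := hT.mem_or_compl_mem ∅ (Set.empty_subset _) (by omega)
  · exact Nat.le_zero.1 (h0 ▸ tangleRk_le_conn h subset_rfl)
  · exact absurd (by simp) (hT.union_ne _ h _ h _ h)

variable [M.Finite]

lemma IsTangle.tangleRk_insert_le (hT : M.IsTangle T θ) (X : Set α) {e : α} (he : e ∈ M.E) :
    M.tangleRk T θ (insert e X) ≤ M.tangleRk T θ X + 1 := by
  obtain hle | hlt := le_or_gt θ (M.tangleRk T θ X + 1)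
  · exact (hT.tangleRk_le _).trans hle
  obtain h | ⟨Y, hY, hXY, h⟩ := tangleRk_eq_or (M := M) (T := T) (θ := θ) X
  · omega
  have h1 := M.conn_singleton_le e
  have he' : {e} ∈ T := (hT.mem_or_compl_mem {e} (by simpa) (by omega)).resolve_right
    (hT.compl_singleton_notMem e he)
  have h2 := M.conn_submod Y {e}
  have h3 := hT.tangleRk_le_conn_of_subset_union (X := insert e X) (Y := Y ∪ {e})
    (by rw [Set.union_singleton]; exact Set.insert_subset_insert hXY) hY he' subset_rfl
  omega

lemma IsTangle.tangleRk_submod (hT : M.IsTangle T θ) (A B : Set α) :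
    M.tangleRk T θ (A ∩ B) + M.tangleRk T θ (A ∪ B) ≤
      M.tangleRk T θ A + M.tangleRk T θ B := by
  have hA := hT.tangleRk_mono (Set.inter_subset_left (s := A) (t := B))
  have hB := hT.tangleRk_mono (Set.inter_subset_right (s := A) (t := B))
  have hU := hT.tangleRk_le (A ∪ B)
  obtain h | ⟨Y, hY, hAY, h⟩ := tangleRk_eq_or (M := M) (T := T) (θ := θ) A
  · omega
  obtain h' | ⟨Z, hZ, hBZ, h'⟩ := tangleRk_eq_or (M := M) (T := T) (θ := θ) B
  · omega
  have h1 := hT.tangleRk_le_conn_of_subset_union (Set.inter_subset_inter hAY hBZ) hY hZ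
    (Set.inter_subset_left.trans Set.subset_union_left)
  have h2 := hT.tangleRk_le_conn_of_subset_union (Set.union_subset_union hAY hBZ) hY hZ
    subset_rfl
  have h3 := M.conn_submod Y Z
  omega

/-- The tangle matroid `M(T)` of a tangle `T` of `M`: the matroid on `E(M)` with rank
function `tangleRk`, see `IsTangle.eRk_matroid`. -/
def IsTangle.matroid (hT : M.IsTangle T θ) : Matroid α :=
  ofRankFun M.ground_finite (M.tangleRk T θ) hT.tangleRk_empty
    (fun _ _ h _ => hT.tangleRk_mono h)
    (fun X _ _ he => hT.tangleRk_insert_le X he)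
    (fun X _ Y _ => hT.tangleRk_submod X Y)

lemma IsTangle.matroid_ground (hT : M.IsTangle T θ) : hT.matroid.E = M.E := rfl

lemma IsTangle.eRk_matroid (hT : M.IsTangle T θ) {X : Set α} (hX : X ⊆ M.E) :
    hT.matroid.eRk X = M.tangleRk T θ X :=
  eRk_ofRankFun _ _ _ _ _ hX

end TangleMatroid

end

end Matroid

/-!
A cocircuit of `M` is dependent in the tangle matroid, while a subset of `M.E` with at most two
elements is independent there. Hence the fans, lying in skew lines of the tangle matroid, are
disjoint, and no four-element cocircuit consists of two elements of one fan and two of another.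
Since `M ＼ {e i}` is `3`-connected, `e i` lies in no triad, so it is an end of its fan and there are
a triangle `{e i, f i, g i}` and a triad `{f i, g i, h i}`. By orthogonality a cocircuit containing
`e i` contains `f i` or `g i`, so every cocircuit keeps at least three elements when all `e i` are
deleted; in particular the triads survive.

A `k`-separation of `M ＼ Set.range e` with `k < 3` that splits a pair `{f i, g i}` can be shifted
along the triad `{f i, g i, h i}`: one side contains `h i` and one of `f i`, `g i`, and absorbs the
other. Once no pair is split, each `e i` is spanned by the side containing `{f i, g i}` and can be
put back there, which gives a separation of `M`.

The minor `N` survives the deletions one at a time: if `e i` is contracted rather than deleted, then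
`f i` and `g i` become parallel and are in a triad with `h i`, and in every case the elements to be
removed can be exchanged within the triangle and the triad until `e i` is deleted.
-/

namespace TangleFans

open Matroid

section Connectivity

variable {α : Type*} {M : Matroid α} {A B D K X Y : Set α} {x : α} {k n : ℕ}

lemma conn_compl (hX : X ⊆ M.E) : M.conn (M.E \ X) = M.conn X := by
  rw [conn, conn, Set.sdiff_sdiff_cancel_left hX, add_comm]

lemma notMem_closure_of_isCocircuit (hK : M.IsCocircuit K) (hxK : x ∈ K) (hxB : x ∉ B)
    (hKB : K ∩ B ⊆ {x}) : x ∉ M.closure B := by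
  intro hxcl
  obtain ⟨C, hCB, hC, hxC⟩ := exists_isCircuit_of_mem_closure hxcl hxB
  refine hC.inter_isCocircuit_ne_singleton (e := x) hK (Set.Subset.antisymm ?_ (by simp [*]))
  rintro y ⟨hyC, hyK⟩
  exact (hCB hyC).elim id fun hyB => hKB ⟨hyK, hyB⟩

lemma coindep_delete (hD : M.Coindep (B ∪ D)) (hBD : Disjoint B D) : (M ＼ D).Coindep B := by
  have hind : M✶.Indep (B ∪ D) := hD
  rw [coindep_def, dual_delete, (hind.subset Set.subset_union_right).contract_indep_iff]
  exact ⟨hBD, hind⟩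

lemma exists_isCocircuit_delete_subset (hK : M.IsCocircuit K) (hKD : Disjoint K D) :
    ∃ L ⊆ K, (M ＼ D).IsCocircuit L := by
  simp only [isCocircuit_def, dual_delete]
  exact (hK.isCircuit.contract_dep hKD.symm).exists_isCircuit_subset

variable [M.Finite]

lemma conn_add_natRk_ground (M : Matroid α) [M.Finite] (X : Set α) :
    M.conn X + M.natRk M.E = M.natRk X + M.natRk (M.E \ X) :=
  Nat.sub_add_cancel (M.natRk_ground_le X)

lemma natRk_le_of_subset_closure (h : X ⊆ M.closure Y) : M.natRk X ≤ M.natRk Y := by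
  rw [← ENat.natCast_le_natCast, cast_natRk, cast_natRk, ← M.eRk_closure_eq Y]
  exact M.eRk_mono h

lemma natRk_mono (h : X ⊆ Y) : M.natRk X ≤ M.natRk Y := by
  rw [← ENat.natCast_le_natCast, cast_natRk, cast_natRk]
  exact M.eRk_mono h

lemma natRk_insert_le : M.natRk (insert x X) ≤ M.natRk X + 1 := by
  rw [← ENat.natCast_le_natCast, ENat.natCast_add, cast_natRk, cast_natRk]
  exact M.eRk_insert_le_add_one x X

lemma natRk_insert_eq (hx : x ∈ M.E \ M.closure X) :
    M.natRk (insert x X) = M.natRk X + 1 := by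
  rw [← ENat.natCast_inj, ENat.natCast_add, cast_natRk, cast_natRk]
  exact eRk_insert_eq_add_one hx

lemma natRk_le_ncard (hX : X ⊆ M.E) : M.natRk X ≤ X.ncard := by
  rw [← ENat.natCast_le_natCast, cast_natRk, (M.ground_finite.subset hX).cast_ncard_eq]
  exact M.eRk_le_encard X

lemma natRk_eq_ncard_iff (hX : X ⊆ M.E) : M.natRk X = X.ncard ↔ M.Indep X := by
  rw [indep_iff_eRk_eq_encard, ← ENat.natCast_inj, cast_natRk,
    (M.ground_finite.subset hX).cast_ncard_eq]

lemma coindep_iff_natRk_ground_le (hX : X ⊆ M.E) :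
    M.Coindep X ↔ M.natRk M.E ≤ M.natRk (M.E \ X) := by
  rw [coindep_iff_compl_spanning, spanning_iff_eRk_le, eRank_def, ← ENat.natCast_le_natCast,
    cast_natRk, cast_natRk]

lemma conn_le_ncard (hX : X ⊆ M.E) : M.conn X ≤ X.ncard := by
  have hconn := conn_add_natRk_ground M X
  have hrank := natRk_le_ncard hX
  have hcompl : M.natRk (M.E \ X) ≤ M.natRk M.E := natRk_mono Set.sdiff_subset
  omega

lemma conn_eq_ncard_iff (hX : X ⊆ M.E) : M.conn X = X.ncard ↔ M.Indep X ∧ M.Coindep X := by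
  rw [← natRk_eq_ncard_iff hX, coindep_iff_natRk_ground_le hX]
  have hconn := conn_add_natRk_ground M X
  have hrank := natRk_le_ncard hX
  have hcompl : M.natRk (M.E \ X) ≤ M.natRk M.E := natRk_mono Set.sdiff_subset
  omega

lemma conn_lt_ncard_of_isCocircuit (hK : M.IsCocircuit K) : M.conn K < K.ncard :=
  (conn_le_ncard hK.subset_ground).lt_of_ne fun h =>
    hK.isCircuit.not_indep ((conn_eq_ncard_iff hK.subset_ground).1 h).2

lemma conn_insert_le_of_isCocircuit (hK : M.IsCocircuit K) (hxK : x ∈ K) (hKA : K \ {x} ⊆ A) :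
    M.conn (insert x A) ≤ M.conn A := by
  by_cases hxA : x ∈ A
  · rw [Set.insert_eq_of_mem hxA]
  have hxE : x ∈ M.E := hK.subset_ground hxK
  have hx : x ∉ M.closure (M.E \ insert x A) :=
    notMem_closure_of_isCocircuit hK hxK (fun h => h.2 (Set.mem_insert x A))
      fun y hy => by_contra fun hyx => hy.2.2 (Or.inr (hKA ⟨hy.1, hyx⟩))
  have hcompl : insert x (M.E \ insert x A) = M.E \ A := by
    ext y
    by_cases hyx : y = x <;> simp [hyx, hxE, hxA]
  have hrank_compl := natRk_insert_eq ⟨hxE, hx⟩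
  rw [hcompl] at hrank_compl
  have hrank : M.natRk (insert x A) ≤ M.natRk A + 1 := natRk_insert_le
  have hconn := conn_add_natRk_ground M A
  have hconn_insert := conn_add_natRk_ground M (insert x A)
  omega

lemma conn_le_conn_delete (hA : A ⊆ M.E \ D) (hX : X ⊆ M.closure A)
    (hXc : M.E \ X ⊆ M.closure ((M.E \ D) \ A)) : M.conn X ≤ (M ＼ D).conn A := by
  have natRk_delete : ∀ Y ⊆ M.E \ D, (M ＼ D).natRk Y = M.natRk Y := fun Y hY => by
    rw [natRk, natRk, delete_eq_restrict, restrict_eRk_eq _ hY]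
  have hconn := conn_add_natRk_ground M X
  have hconn_delete := conn_add_natRk_ground (M ＼ D) A
  rw [delete_ground, natRk_delete _ subset_rfl, natRk_delete _ hA,
    natRk_delete _ Set.sdiff_subset] at hconn_delete
  have hground : M.natRk (M.E \ D) ≤ M.natRk M.E := natRk_mono Set.sdiff_subset
  have hrank := natRk_le_of_subset_closure hX
  have hrank_compl := natRk_le_of_subset_closure hXc
  omega

lemma isKConnected_iff : M.IsKConnected n ↔ ∀ k < n, ∀ X ⊆ M.E, M.conn X < k →
    X.ncard < k ∨ (M.E \ X).ncard < k := by
  have cast_le_encard {k : ℕ} {Y : Set α} (hY : Y ⊆ M.E) : (k : ℕ∞) ≤ Y.encard ↔ k ≤ Y.ncard := by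
    rw [← (M.ground_finite.subset hY).cast_ncard_eq, ENat.natCast_le_natCast]
  constructor
  · intro hM k hk X hX hconn
    by_contra! hcard
    exact hM k hk X (M.E \ X) ⟨Set.union_sdiff_cancel hX, Set.disjoint_sdiff_right,
      (cast_le_encard hX).2 hcard.1, (cast_le_encard Set.sdiff_subset).2 hcard.2, hconn⟩
  · rintro h k hk X Y ⟨hXY, hdj, hXk, hYk, hconn⟩
    have hX : X ⊆ M.E := hXY ▸ Set.subset_union_left
    have hY : M.E \ X = Y := by rw [← hXY, Set.union_sdiff_left, hdj.symm.sdiff_eq_left]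
    rw [cast_le_encard hX] at hXk
    rw [← hY, cast_le_encard Set.sdiff_subset] at hYk
    have := h k hk X hX hconn
    omega

lemma conn_eq_ncard_of_isKConnected (hM : M.IsKConnected n) (hX : X ⊆ M.E) (hXn : X.ncard < n)
    (hXE : 2 * X.ncard ≤ M.E.ncard) : M.conn X = X.ncard := by
  by_contra hne
  have hsep := isKConnected_iff.1 hM _ hXn X hX ((conn_le_ncard hX).lt_of_ne hne)
  have hcard := Set.ncard_sdiff_add_ncard_of_subset hX M.ground_finite
  omega

lemma le_ncard_of_isCocircuit_of_isKConnected (hM : M.IsKConnected n) (hK : M.IsCocircuit K)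
    (hKE : 2 * K.ncard ≤ M.E.ncard) : n ≤ K.ncard := by
  by_contra! hKn
  exact (conn_lt_ncard_of_isCocircuit hK).ne
    (conn_eq_ncard_of_isKConnected hM hK.subset_ground hKn hKE)

lemma notMem_of_isCocircuit_of_isKConnected_delete (hM : (M ＼ {x}).IsKConnected n)
    (hK : M.IsCocircuit K) (hK_nontrivial : K.Nontrivial) (hKn : K.ncard ≤ n)
    (hKE : 2 * K.ncard ≤ M.E.ncard + 1) : x ∉ K := by
  intro hx
  have hKx : (M ＼ {x}).IsCocircuit (K \ {x}) :=
    hK.delete_isCocircuit ((Set.singleton_subset_iff.2 hx).ssubset_of_ne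
      hK_nontrivial.ne_singleton.symm)
  have hKfin := M.ground_finite.subset hK.subset_ground
  have hKcard := Set.ncard_sdiff_singleton_add_one hx hKfin
  have hEcard := Set.ncard_sdiff_singleton_add_one (hK.subset_ground hx) M.ground_finite
  have := le_ncard_of_isCocircuit_of_isKConnected hM hKx (by rw [delete_ground]; omega)
  omega

lemma ncard_lt_or_of_ncard_insert_lt_or (hconn_eq : ∀ B ⊆ M.E, B.ncard = k → M.conn B = k)
    (hA : A ⊆ M.E) (hconn : M.conn A < k) (hx : x ∈ M.E \ A)
    (h : (insert x A).ncard < k ∨ (M.E \ insert x A).ncard < k) :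
    A.ncard < k ∨ (M.E \ A).ncard < k := by
  refine h.imp (fun h => ?_) fun h => ?_
  · rw [Set.ncard_insert_of_notMem hx.2 (M.ground_finite.subset hA)] at h
    omega
  · rw [← Set.union_singleton, ← Set.sdiff_sdiff] at h
    have hcard := Set.ncard_sdiff_singleton_add_one hx (M.ground_finite.sdiff (t := A))
    have hne : (M.E \ A).ncard ≠ k := fun hk => by
      have := hconn_eq _ Set.sdiff_subset hk
      rw [conn_compl hA] at this
      omega
    omega

end Connectivity

section FanSystem

lemma ne_of_encard_eq_three {α : Type*} {a b c : α} (h : ({a, b, c} : Set α).encard = 3) :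
    a ≠ b ∧ a ≠ c ∧ b ≠ c := by
  have hpair (x y : α) (hxy : ({a, b, c} : Set α) = {x, y}) : False := by
    have hle : ({x, y} : Set α).encard ≤ 2 := by
      simpa [one_add_one_eq_two] using Set.encard_insert_le {y} x
    exact absurd (h ▸ hxy ▸ hle) (by decide)
  refine ⟨?_, ?_, ?_⟩ <;> rintro rfl
  · exact hpair a c (by grind)
  · exact hpair a b (by grind)
  · exact hpair a b (by grind)

/-- A family of pairwise disjoint four-element fans `(e i, f i, g i, h i)` of `M` which start with
a triangle and continue with a triad, such that deleting the ends `e i` creates no small cocircuit: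
`e i` is in no triad, and no four-element cocircuit meets each of two triangles `{e i, f i, g i}`
and `{e j, f j, g j}` in two elements including `e i` and `e j` respectively. -/
structure FanSystem {α ι : Type*} (M : Matroid α) (e f g h : ι → α) : Prop where
  isTriangle (i : ι) : M.IsTriangle {e i, f i, g i}
  isTriad (i : ι) : M.IsTriad {f i, g i, h i}
  disjoint : Pairwise fun i j =>
    Disjoint ({e i, f i, g i, h i} : Set α) {e j, f j, g j, h j}
  notMem_of_isTriad (i : ι) {K : Set α} (hK : M.IsTriad K) : e i ∉ K
  not_isCocircuit {i j : ι} (hij : i ≠ j) {x y : α} (hx : x ∈ ({f i, g i} : Set α))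
    (hy : y ∈ ({f j, g j} : Set α)) : ¬ M.IsCocircuit {e i, x, e j, y}

/-- The indices `i` for which the pair `{f i, g i}` has exactly one element in `A`. They are the
obstruction to putting the elements `e i` back into `A` or its complement. -/
def splitIndices {α ι : Type*} (f g : ι → α) (A : Set α) : Set ι :=
  {i | ¬(f i ∈ A ↔ g i ∈ A)}

namespace FanSystem

variable {α ι : Type*} {M : Matroid α} {A B D K : Set α} {e f g h : ι → α} {i : ι} {x : α}
  {k n : ℕ}

lemma index_eq (H : FanSystem M e f g h) {j : ι} (hi : x ∈ ({e i, f i, g i, h i} : Set α))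
    (hj : x ∈ ({e j, f j, g j, h j} : Set α)) : i = j :=
  by_contra fun hij => Set.disjoint_left.1 (H.disjoint hij) hi hj

lemma triad_disjoint_range (H : FanSystem M e f g h) (i : ι) :
    Disjoint ({f i, g i, h i} : Set α) (Set.range e) := by
  rw [Set.disjoint_left]
  rintro x hx ⟨j, rfl⟩
  obtain rfl := H.index_eq (Or.inr hx) (Set.mem_insert _ _)
  exact H.notMem_of_isTriad _ (H.isTriad _) hx

lemma mem_ground_of_mem_range (H : FanSystem M e f g h) (hx : x ∈ Set.range e) : x ∈ M.E := by
  obtain ⟨i, rfl⟩ := hx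
  exact (H.isTriangle i).1.subset_ground (Set.mem_insert _ _)

lemma mem_ground_sdiff_range (H : FanSystem M e f g h) (hx : x ∈ ({f i, g i, h i} : Set α)) :
    x ∈ M.E \ Set.range e :=
  ⟨(H.isTriad i).1.subset_ground hx, Set.disjoint_left.1 (H.triad_disjoint_range i) hx⟩

lemma splitIndices_compl (H : FanSystem M e f g h) (A : Set α) :
    splitIndices f g ((M.E \ Set.range e) \ A) = splitIndices f g A := by
  ext i
  have hf : f i ∈ M.E \ Set.range e := H.mem_ground_sdiff_range (Set.mem_insert _ _)
  have hg : g i ∈ M.E \ Set.range e := H.mem_ground_sdiff_range (Or.inr (Set.mem_insert _ _))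
  simp only [splitIndices, Set.mem_ofPred_eq, Set.mem_sdiff (s := M.E \ Set.range e), hf, hg,
    true_and, not_iff_not]

lemma mem_closure (H : FanSystem M e f g h) (hf : f i ∈ A) (hg : g i ∈ A) :
    e i ∈ M.closure A := by
  refine M.closure_subset_closure ?_
    ((H.isTriangle i).1.mem_closure_sdiff_singleton_of_mem (Set.mem_insert _ _))
  simp only [Set.sdiff_singleton_subset_iff, Set.insert_subset_iff, Set.singleton_subset_iff,
    Set.mem_insert_iff]
  tauto

lemma exists_mem_pair (H : FanSystem M e f g h) (hK : M.IsCocircuit K) (hi : e i ∈ K) :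
    ∃ x ∈ K \ Set.range e, x ∈ ({f i, g i} : Set α) := by
  suffices h : ∃ x ∈ K, x ∈ ({f i, g i} : Set α) by
    obtain ⟨x, hxK, hx⟩ := h
    refine ⟨x, ⟨hxK, Set.disjoint_left.1 (H.triad_disjoint_range i) ?_⟩, hx⟩
    exact Set.insert_subset_insert (Set.singleton_subset_iff.2 (Set.mem_insert _ _)) hx
  by_contra! h
  refine (H.isTriangle i).1.inter_isCocircuit_ne_singleton (e := e i) hK
    (Set.Subset.antisymm ?_ (by simp [hi]))
  rintro x ⟨rfl | hx, hxK⟩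
  · rfl
  · exact absurd hx (h x hxK)

variable [M.Finite]

lemma ncard_inter_range_le (H : FanSystem M e f g h) (hK : M.IsCocircuit K) :
    (K ∩ Set.range e).ncard ≤ (K \ Set.range e).ncard := by
  have hpartner : ∀ x ∈ K ∩ Set.range e, ∃ y ∈ K \ Set.range e,
      ∃ i, e i = x ∧ y ∈ ({f i, g i} : Set α) := by
    rintro _ ⟨hxK, i, rfl⟩
    obtain ⟨y, hy, hyi⟩ := H.exists_mem_pair hK hxK
    exact ⟨y, hy, i, rfl, hyi⟩
  choose! p hpK hp using hpartner
  refine Set.ncard_le_ncard_of_injOn p hpK (fun x hx y hy hxy => ?_)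
    ((M.ground_finite.subset hK.subset_ground).sdiff)
  obtain ⟨i, rfl, hi⟩ := hp x hx
  obtain ⟨j, rfl, hj⟩ := hp y hy
  rw [hxy] at hi
  have pair_subset (k : ι) : ({f k, g k} : Set α) ⊆ {e k, f k, g k, h k} := by grind
  rw [H.index_eq (pair_subset i hi) (pair_subset j hj)]

lemma three_le_ncard_sdiff_range (H : FanSystem M e f g h) (hM : M.IsKConnected 3)
    (hE : 4 ≤ M.E.ncard) (hK : M.IsCocircuit K) : 3 ≤ (K \ Set.range e).ncard := by
  by_contra! hlt
  have hKfin : K.Finite := M.ground_finite.subset hK.subset_ground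
  have hinter := H.ncard_inter_range_le hK
  have hcard := Set.ncard_inter_add_ncard_sdiff_eq_ncard K (Set.range e) hKfin
  have hthree : 3 ≤ K.ncard := by
    by_contra! h
    have := le_ncard_of_isCocircuit_of_isKConnected hM hK (by omega)
    omega
  obtain hKcard | hKcard : K.ncard = 3 ∨ K.ncard = 4 := by omega
  · obtain ⟨_, hxK, i, rfl⟩ : (K ∩ Set.range e).Nonempty :=
      (Set.ncard_pos (hKfin.inter_of_left _)).1 (by omega)
    exact H.notMem_of_isTriad i ⟨hK, by rw [← hKfin.cast_ncard_eq, hKcard]; rfl⟩ hxK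
  · obtain ⟨x, y, hxy, hKe⟩ := Set.ncard_eq_two.1 (show (K ∩ Set.range e).ncard = 2 by omega)
    obtain ⟨hxK, i, rfl⟩ : x ∈ K ∩ Set.range e := hKe ▸ Set.mem_insert _ _
    obtain ⟨hyK, j, rfl⟩ : y ∈ K ∩ Set.range e := hKe ▸ Or.inr rfl
    obtain ⟨p, hpK, hp⟩ := H.exists_mem_pair hK hxK
    obtain ⟨q, hqK, hq⟩ := H.exists_mem_pair hK hyK
    have hij : i ≠ j := fun h => hxy (congrArg e h)
    have hpq : p ≠ q := by
      rintro rfl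
      exact hij (H.index_eq (x := p) (by grind) (by grind))
    refine H.not_isCocircuit hij hp hq ?_
    have hpair : {p, q} = K \ Set.range e :=
      Set.eq_of_subset_of_ncard_le (Set.insert_subset hpK (Set.singleton_subset_iff.2 hqK))
        (by rw [Set.ncard_pair hpq]; omega) hKfin.sdiff
    convert hK using 1
    rw [← Set.inter_union_sdiff K (Set.range e), hKe, ← hpair]
    grind

lemma coindep_delete (H : FanSystem M e f g h) (hM : M.IsKConnected 3) (hE : 4 ≤ M.E.ncard)
    (hD : D ⊆ Set.range e) (hB : B ⊆ M.E \ D) (hB_card : B.ncard ≤ 2) :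
    (M ＼ D).Coindep B := by
  have hBfin : B.Finite := M.ground_finite.subset (hB.trans Set.sdiff_subset)
  refine TangleFans.coindep_delete ?_ (Set.disjoint_of_subset_left hB Set.disjoint_sdiff_left)
  by_contra hBD
  have hBDE : B ∪ D ⊆ M✶.E := Set.union_subset (hB.trans Set.sdiff_subset)
    fun x hx => H.mem_ground_of_mem_range (hD hx)
  obtain ⟨K, hKBD, hK⟩ := ((not_indep_iff hBDE).1 hBD).exists_isCircuit_subset
  have hKB : K \ Set.range e ⊆ B := fun x hx =>
    (hKBD hx.1).resolve_right fun hxD => hx.2 (hD hxD)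
  have := H.three_le_ncard_sdiff_range hM hE hK
  have := Set.ncard_le_ncard hKB hBfin
  omega

lemma conn_delete_eq_ncard (H : FanSystem M e f g h) (hM : M.IsKConnected 3)
    (hE : 4 ≤ M.E.ncard) (hD : D ⊆ Set.range e) (hB : B ⊆ M.E \ D) (hB_card : B.ncard ≤ 2) :
    (M ＼ D).conn B = B.ncard := by
  refine (conn_eq_ncard_iff hB).2 ⟨?_, H.coindep_delete hM hE hD hB hB_card⟩
  have hBE := hB.trans Set.sdiff_subset
  have hB_indep := ((conn_eq_ncard_iff hBE).1
    (conn_eq_ncard_of_isKConnected hM hBE (by omega) (by omega))).1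
  exact delete_indep_iff.2 ⟨hB_indep, Set.disjoint_of_subset_left hB Set.disjoint_sdiff_left⟩

lemma isTriad_delete (H : FanSystem M e f g h) (hM : M.IsKConnected 3) (hE : 4 ≤ M.E.ncard)
    (hD : D ⊆ Set.range e) (i : ι) : (M ＼ D).IsTriad {f i, g i, h i} := by
  obtain ⟨hK, hcard⟩ := H.isTriad i
  obtain ⟨L, hLK, hL⟩ := exists_isCocircuit_delete_subset (D := D) hK
    ((H.triad_disjoint_range i).mono_right hD)
  have hKfin : ({f i, g i, h i} : Set α).Finite := by simp
  have hL_card : 2 < L.ncard := by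
    by_contra! h
    exact hL.isCircuit.not_indep (H.coindep_delete hM hE hD hL.subset_ground h)
  have hLK : L = {f i, g i, h i} := Set.eq_of_subset_of_ncard_le hLK
    (by rw [Set.ncard_def, hcard]; exact hL_card) hKfin
  exact ⟨hLK ▸ hL, hcard⟩

lemma ncard_lt_or_of_splitIndices_eq_empty (H : FanSystem M e f g h) (hM : M.IsKConnected n)
    (hA : A ⊆ M.E \ Set.range e) (hkn : k < n) (hconn : (M ＼ Set.range e).conn A < k)
    (hsplit : splitIndices f g A = ∅) :
    A.ncard < k ∨ ((M.E \ Set.range e) \ A).ncard < k := by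
  have hsplit' (i : ι) : f i ∈ A ↔ g i ∈ A :=
    not_not.1 fun hi => (hsplit ▸ hi : i ∈ (∅ : Set ι))
  set A' := A ∪ e '' {i | f i ∈ A}
  have hA'E : A' ⊆ M.E := Set.union_subset (hA.trans Set.sdiff_subset)
    fun x ⟨i, _, hx⟩ => H.mem_ground_of_mem_range ⟨i, hx⟩
  have hA'_closure : A' ⊆ M.closure A := by
    refine Set.union_subset (M.subset_closure A (hA.trans Set.sdiff_subset)) ?_
    rintro _ ⟨i, hi, rfl⟩
    exact H.mem_closure hi ((hsplit' i).1 hi)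
  have hcompl_closure : M.E \ A' ⊆ M.closure ((M.E \ Set.range e) \ A) := by
    rintro x ⟨hxE, hxA'⟩
    by_cases hx : x ∈ Set.range e
    · obtain ⟨i, rfl⟩ := hx
      have hfA : f i ∉ A := fun hi => hxA' (Or.inr ⟨i, hi, rfl⟩)
      exact H.mem_closure ⟨H.mem_ground_sdiff_range (Set.mem_insert _ _), hfA⟩
        ⟨H.mem_ground_sdiff_range (Or.inr (Set.mem_insert _ _)), (hsplit' i).not.1 hfA⟩
    · exact M.mem_closure_of_mem ⟨⟨hxE, hx⟩, fun hxA => hxA' (Or.inl hxA)⟩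
        (Set.sdiff_subset.trans Set.sdiff_subset)
  have hcompl : (M.E \ Set.range e) \ A ⊆ M.E \ A' := by
    rintro x ⟨⟨hxE, hx⟩, hxA⟩
    exact ⟨hxE, fun hxA' => hxA'.elim hxA fun ⟨i, _, hi⟩ => hx ⟨i, hi⟩⟩
  refine (isKConnected_iff.1 hM k hkn A' hA'E
    ((conn_le_conn_delete hA hA'_closure hcompl_closure).trans_lt hconn)).imp ?_ ?_
  · exact (Set.ncard_le_ncard Set.subset_union_left (M.ground_finite.subset hA'E)).trans_lt
  · exact (Set.ncard_le_ncard hcompl M.ground_finite.sdiff).trans_lt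

lemma exists_insert_splitIndices_ssubset (H : FanSystem M e f g h)
    (hM : M.IsKConnected 3) (hE : 4 ≤ M.E.ncard) (hi : i ∈ splitIndices f g A) (hhi : h i ∈ A) :
    ∃ x ∈ (M.E \ Set.range e) \ A, (M ＼ Set.range e).conn (insert x A) ≤
      (M ＼ Set.range e).conn A ∧ splitIndices f g (insert x A) ⊂ splitIndices f g A := by
  -- Adding the missing one of `f i`, `g i` to `A` completes the triad `{f i, g i, h i}`.
  obtain ⟨x, hx, hxA, hrest⟩ : ∃ x ∈ ({f i, g i} : Set α), x ∉ A ∧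
      ({f i, g i, h i} : Set α) \ {x} ⊆ A := by
    simp only [splitIndices, Set.mem_ofPred_eq] at hi
    by_cases hf : f i ∈ A <;> grind
  have hx_triad : x ∈ ({f i, g i, h i} : Set α) := by grind
  refine ⟨x, ⟨H.mem_ground_sdiff_range hx_triad, hxA⟩,
    conn_insert_le_of_isCocircuit (H.isTriad_delete hM hE subset_rfl i).1 hx_triad hrest, ?_⟩
  refine (Set.ssubset_iff_of_subset fun j hj => ?_).2 ⟨i, hi, ?_⟩
  · by_cases hij : i = j
    · exact hij ▸ hi
    have hxj : x ∉ ({e j, f j, g j, h j} : Set α) :=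
      fun hxj => hij (H.index_eq (Or.inr hx_triad) hxj)
    grind [splitIndices]
  · grind [splitIndices]

lemma ncard_lt_or_of_conn_delete_lt [Finite ι] (H : FanSystem M e f g h) (hM : M.IsKConnected 3)
    (hE : 4 ≤ M.E.ncard) (hk : k < 3) (hA : A ⊆ M.E \ Set.range e)
    (hconn : (M ＼ Set.range e).conn A < k) :
    A.ncard < k ∨ ((M.E \ Set.range e) \ A).ncard < k := by
  induction hs : splitIndices f g A using WellFoundedLT.induction generalizing A with
  | ind s ih =>
  subst hs
  obtain hsplit | ⟨i, hi⟩ := (splitIndices f g A).eq_empty_or_nonempty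
  · exact H.ncard_lt_or_of_splitIndices_eq_empty hM hA hk hconn hsplit
  wlog hhi : h i ∈ A generalizing A
  · have hhi_compl : h i ∈ (M.E \ Set.range e) \ A :=
      ⟨H.mem_ground_sdiff_range (Or.inr (Or.inr rfl)), hhi⟩
    have hcompl := this Set.sdiff_subset ((conn_compl (M := M ＼ Set.range e) hA).trans_lt hconn)
      (by rwa [H.splitIndices_compl A]) (by rwa [H.splitIndices_compl A]) hhi_compl
    rw [Set.sdiff_sdiff_cancel_left hA] at hcompl
    exact hcompl.symm
  obtain ⟨x, hx, hconn_insert, hssub⟩ := H.exists_insert_splitIndices_ssubset hM hE hi hhi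
  exact ncard_lt_or_of_ncard_insert_lt_or (M := M ＼ Set.range e)
    (fun B hB hBk => (H.conn_delete_eq_ncard hM hE subset_rfl hB (by omega)).trans hBk) hA hconn hx
    (ih _ hssub (Set.insert_subset hx.1 hA) (hconn_insert.trans_lt hconn) rfl)

theorem isKConnected_delete [Finite ι] (H : FanSystem M e f g h) (hM : M.IsKConnected 3)
    (hE : 4 ≤ M.E.ncard) : (M ＼ Set.range e).IsKConnected 3 :=
  isKConnected_iff.2 fun _ hk _ hA hconn => H.ncard_lt_or_of_conn_delete_lt hM hE hk hA hconn

end FanSystem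
end FanSystem

section Minor

variable {α : Type*} {M N : Matroid α} {C D K : Set α} {x y : α}

lemma isMinor_of_isMinor_delete (h : N ≤m M ＼ D) : N ≤m M :=
  h.trans ⟨∅, D, by rw [contract_empty]⟩

lemma isMinor_of_isMinor_contract (h : N ≤m M ／ C) : N ≤m M :=
  h.trans ⟨C, ∅, by rw [delete_empty]⟩

lemma isMinor_of_ground_eq_empty (h : N.E = ∅) : N ≤m M := by
  refine ⟨M.E, ∅, ?_⟩
  rw [ground_eq_empty_iff.1 h, eq_comm, ← ground_eq_empty_iff]
  simp

lemma isMinor_dual (h : N ≤m M) : N✶ ≤m M✶ := by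
  obtain ⟨C, D, -, -, hCD, rfl⟩ := h.exists_eq_contract_delete_disjoint
  exact ⟨D, C, by rw [dual_contract_delete, contract_delete_comm _ hCD.symm]⟩

lemma isMinor_delete_or_contract (h : N ≤m M) (hx : x ∉ N.E) :
    N ≤m M ＼ {x} ∨ N ≤m M ／ {x} := by
  obtain ⟨C, D, -, -, -, rfl⟩ := h.exists_eq_contract_delete_disjoint
  by_cases hxC : x ∈ C
  · refine Or.inr ⟨C \ {x}, D, ?_⟩
    rw [contract_contract, Set.union_sdiff_cancel (Set.singleton_subset_iff.2 hxC)]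
  · refine Or.inl ⟨C, D, ?_⟩
    have hdelete : M ／ C ＼ D ＼ {x} = M ／ C ＼ D := deleteElem_eq_self hx
    rw [← contract_delete_comm _ (Set.disjoint_singleton_right.2 hxC), delete_delete,
      Set.union_comm, ← delete_delete, hdelete]

lemma contract_sdiff_delete_of_isCircuit (hC : M.IsCircuit C) (hx : x ∈ C) :
    M ／ (C \ {x}) ＼ {x} = M ／ C := by
  have hloop : {x} ⊆ (M ／ (C \ {x})).loops := by
    rw [contract_loops_eq, Set.singleton_subset_iff]
    exact ⟨hC.mem_closure_sdiff_singleton_of_mem hx, fun h => h.2 rfl⟩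
  rw [← contract_eq_delete_of_subset_loops hloop, contract_contract,
    Set.sdiff_union_of_subset (Set.singleton_subset_iff.2 hx)]

/-- After contracting all but one element of a circuit the last one is a loop, so it does not
matter which element of the circuit is deleted and the others contracted. -/
lemma isMinor_delete_of_isMinor_contract_sdiff (hC : M.IsCircuit C) (hx : x ∈ C) (hy : y ∈ C)
    (hxN : x ∉ N.E) (h : N ≤m M ／ (C \ {x})) : N ≤m M ＼ {y} := by
  have hNC : N ≤m M ／ C := by
    obtain h | h := isMinor_delete_or_contract h hxN
    · rwa [contract_sdiff_delete_of_isCircuit hC hx] at h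
    · rwa [contract_contract, Set.sdiff_union_of_subset (Set.singleton_subset_iff.2 hx)] at h
  rw [← contract_sdiff_delete_of_isCircuit hC hy,
    contract_delete_comm _ Set.disjoint_sdiff_left] at hNC
  exact isMinor_of_isMinor_contract hNC

lemma isMinor_contract_of_isMinor_delete_sdiff (hK : M.IsCocircuit K) (hx : x ∈ K) (hy : y ∈ K)
    (hxN : x ∉ N.E) (h : N ≤m M ＼ (K \ {x})) : N ≤m M ／ {y} := by
  have hdual := isMinor_dual (isMinor_delete_of_isMinor_contract_sdiff hK.isCircuit hx hy
    (N := N✶) hxN (dual_delete M _ ▸ isMinor_dual h))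
  rwa [dual_delete_dual, dual_dual] at hdual

theorem isMinor_delete_of_isTriangle_of_isTriad {e f g h : α} (hN : N ≤m M)
    (hC : M.IsTriangle {e, f, g}) (hK : M.IsTriad {f, g, h}) (heh : e ≠ h)
    (hdj : Disjoint {e, f, g, h} N.E) : N ≤m M ＼ {e} := by
  simp only [Set.disjoint_insert_left, Set.disjoint_singleton_left] at hdj
  obtain ⟨he, hf, hg, hh⟩ := hdj
  obtain ⟨hef, heg, hfg⟩ := ne_of_encard_eq_three hC.2
  obtain ⟨-, hfh, hgh⟩ := ne_of_encard_eq_three hK.2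
  have of_contract_f : N ≤m M ／ {e} ／ {f} → N ≤m M ＼ {e} := fun h => by
    refine isMinor_delete_of_isMinor_contract_sdiff hC.1 (x := g) (by simp) (by simp) hg ?_
    convert h using 1
    rw [contract_contract]
    congr 1; grind
  have of_contract_g : N ≤m M ／ {e} ／ {g} → N ≤m M ＼ {e} := fun h => by
    refine isMinor_delete_of_isMinor_contract_sdiff hC.1 (x := f) (by simp) (by simp) hf ?_
    convert h using 1
    rw [contract_contract]
    congr 1; grind
  have hK_contract : (M ／ {e}).IsCocircuit {f, g, h} :=
    contract_isCocircuit_iff.2 ⟨hK.1, by simp [hef, heg, heh]⟩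
  obtain hN | hNe := isMinor_delete_or_contract hN he
  · exact hN
  obtain hNf | hNf := isMinor_delete_or_contract hNe hf
  swap
  · exact of_contract_f hNf
  refine of_contract_g ?_
  obtain hNg | hNg := isMinor_delete_or_contract hNf hg
  · refine isMinor_contract_of_isMinor_delete_sdiff hK_contract (x := h) (by simp) (by simp) hh ?_
    convert hNg using 1
    rw [delete_delete]
    congr 1; grind
  · rw [← contract_delete_comm _ (Set.disjoint_singleton.2 hfg.symm)] at hNg
    exact isMinor_of_isMinor_delete hNg

theorem FanSystem.isMinor_delete {ι : Type*} [Finite ι] [M.Finite] {e f g h : ι → α}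
    (H : FanSystem M e f g h) (hM : M.IsKConnected 3) (hE : 4 ≤ M.E.ncard) (hN : N ≤m M)
    (hdj : ∀ i, Disjoint {e i, f i, g i, h i} N.E) : N ≤m M ＼ Set.range e := by
  rw [← Set.image_univ]
  induction Set.univ, Set.finite_univ (α := ι) using Set.Finite.induction_on with
  | empty => rwa [Set.image_empty, delete_empty]
  | @insert i s his _ ih =>
    have hs : e '' s ⊆ Set.range e := Set.image_subset_range e s
    have hei : e i ∉ e '' s := fun ⟨j, hj, hji⟩ =>
      his (H.index_eq (Set.mem_insert (e i) _) (Or.inl hji.symm) ▸ hj)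
    have htriangle : (M ＼ (e '' s)).IsTriangle {e i, f i, g i} := by
      refine ⟨delete_isCircuit_iff.2 ⟨(H.isTriangle i).1, ?_⟩, (H.isTriangle i).2⟩
      refine Set.disjoint_insert_left.2 ⟨hei, Set.disjoint_of_subset ?_ hs
        (H.triad_disjoint_range i)⟩
      grind
    have heh : e i ≠ h i := by
      have := H.notMem_of_isTriad i (H.isTriad i)
      grind
    have := isMinor_delete_of_isTriangle_of_isTriad ih htriangle
      (H.isTriad_delete hM hE hs i) heh (hdj i)
    rwa [delete_delete, Set.union_singleton, ← Set.image_insert_eq] at this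

end Minor

section Skew

variable {α ι : Type*} {M : Matroid α} {X X' Y Y' I J : Set α}

/-- The sets `X` and `Y` are skew in `M`: their union has as large a rank as their ranks allow.
Meant for matroids of finite rank, where submodularity turns the inequality into an equality. -/
def Skew (M : Matroid α) (X Y : Set α) : Prop :=
  M.eRk X + M.eRk Y ≤ M.eRk (X ∪ Y)

lemma Skew.symm (h : Skew M X Y) : Skew M Y X := by
  rwa [Skew, add_comm, Set.union_comm]

variable [M.RankFinite]

lemma Skew.mono_left (h : Skew M X Y) (hX : X' ⊆ X) : Skew M X' Y := by
  have hsubmod := M.eRk_inter_add_eRk_union_le (X' ∪ Y) X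
  have hinter : M.eRk X' ≤ M.eRk ((X' ∪ Y) ∩ X) :=
    M.eRk_mono (Set.subset_inter Set.subset_union_left hX)
  have hunion : (X' ∪ Y) ∪ X = X ∪ Y := by grind
  rw [hunion] at hsubmod
  refine (ENat.add_le_add_iff_right (M.eRk_ne_top_iff.2 (RankFinite.isRkFinite X))).1 ?_
  calc M.eRk X' + M.eRk Y + M.eRk X
      = M.eRk X' + (M.eRk X + M.eRk Y) := by ring
    _ ≤ M.eRk ((X' ∪ Y) ∩ X) + M.eRk (X ∪ Y) := add_le_add hinter h
    _ ≤ M.eRk (X' ∪ Y) + M.eRk X := hsubmod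

lemma Skew.mono (h : Skew M X Y) (hX : X' ⊆ X) (hY : Y' ⊆ Y) : Skew M X' Y' :=
  ((h.mono_left hX).symm.mono_left hY).symm

lemma Skew.disjoint_and_indep_union (h : Skew M X Y) (hI : M.Indep I) (hIX : I ⊆ X)
    (hJ : M.Indep J) (hJY : J ⊆ Y) : Disjoint I J ∧ M.Indep (I ∪ J) := by
  have hrank : I.encard + J.encard ≤ M.eRk (I ∪ J) := by
    rw [← hI.eRk_eq_encard, ← hJ.eRk_eq_encard]
    exact h.mono hIX hJY
  have hfin : (I ∪ J).encard ≠ ⊤ := (hI.finite.union hJ.finite).encard_lt_top.ne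
  have hcard := Set.encard_union_add_encard_inter I J
  have hle := M.eRk_le_encard (I ∪ J)
  constructor
  · rw [Set.disjoint_iff_inter_eq_empty, ← Set.encard_eq_zero, ← nonpos_iff_eq_zero]
    refine (ENat.add_le_add_iff_left hfin).1 ?_
    rw [hcard, add_zero]
    exact hrank.trans hle
  · rw [indep_iff_eRk_eq_encard]
    exact hle.antisymm (le_self_add.trans (hcard.trans_le hrank))

lemma eRk_biUnion_le_sum (M : Matroid α) (X : ι → Set α) (s : Finset ι) :
    M.eRk (⋃ i ∈ s, X i) ≤ ∑ i ∈ s, M.eRk (X i) := by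
  classical
  induction s using Finset.induction_on with
  | empty => simp
  | insert i s hi ih =>
    rw [Finset.set_biUnion_insert, Finset.sum_insert hi]
    exact (M.eRk_union_le_eRk_add_eRk _ _).trans (by gcongr)

lemma pairwise_skew_of_sum_eRk_le [Fintype ι] {X : ι → Set α}
    (h : ∑ i, M.eRk (X i) ≤ M.eRk (⋃ i, X i)) : Pairwise fun i j => Skew M (X i) (X j) := by
  classical
  intro i j hij
  set s : Finset ι := Finset.univ \ {i, j}
  have hsum : ∑ k, M.eRk (X k) = M.eRk (X i) + M.eRk (X j) + ∑ k ∈ s, M.eRk (X k) := by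
    rw [← Finset.sum_sdiff (Finset.subset_univ {i, j}), Finset.sum_pair hij, add_comm]
  have hunion : (⋃ k, X k) ⊆ X i ∪ X j ∪ ⋃ k ∈ s, X k := fun x hx => by
    obtain ⟨k, hk⟩ := Set.mem_iUnion.1 hx
    by_cases hks : k ∈ s
    · exact Or.inr (Set.mem_biUnion hks hk)
    · grind
  have hfin : ∑ k ∈ s, M.eRk (X k) ≠ ⊤ :=
    ENat.sum_ne_top.2 fun k _ => M.eRk_ne_top_iff.2 (RankFinite.isRkFinite _)
  refine (ENat.add_le_add_iff_right hfin).1 ?_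
  calc M.eRk (X i) + M.eRk (X j) + ∑ k ∈ s, M.eRk (X k)
      ≤ M.eRk (⋃ k, X k) := hsum ▸ h
    _ ≤ M.eRk (X i ∪ X j ∪ ⋃ k ∈ s, X k) := M.eRk_mono hunion
    _ ≤ M.eRk (X i ∪ X j) + M.eRk (⋃ k ∈ s, X k) := M.eRk_union_le_eRk_add_eRk _ _
    _ ≤ M.eRk (X i ∪ X j) + ∑ k ∈ s, M.eRk (X k) := by
      gcongr
      exact eRk_biUnion_le_sum M X s

end Skew

section Tangle

variable {α : Type*} {M : Matroid α} [M.Finite] {T : Set (Set α)} {θ n : ℕ} {X Y Z K : Set α}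
  {a b c d : α}

instance tangleMatroid_finite (hT : M.IsTangle T θ) : hT.matroid.Finite :=
  ⟨M.ground_finite⟩

lemma mem_tangle_of_ncard_le (hT : M.IsTangle T θ) (hZ : Z ⊆ M.E) (hZθ : Z.ncard ≤ θ)
    (hconn : M.conn Z < θ) : Z ∈ T := by
  refine (hT.mem_or_compl_mem Z hZ hconn).elim id fun hZc => ?_
  induction Z, M.ground_finite.subset hZ using Set.Finite.induction_on with
  | empty => exact absurd (by simp) (hT.union_ne _ hZc _ hZc _ hZc)
  | @insert a Z ha hZfin ih =>
    obtain ⟨haE, hZE⟩ := Set.insert_subset_iff.1 hZ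
    obtain rfl | hZne := Z.eq_empty_or_nonempty
    · exact absurd (by simpa using hZc) (hT.compl_singleton_notMem a haE)
    have hcard := Set.ncard_insert_of_notMem ha hZfin
    have hpos := (Set.ncard_pos hZfin).2 hZne
    have hZconn := conn_le_ncard hZE
    have hZT : Z ∈ T :=
      (hT.mem_or_compl_mem Z hZE (by omega)).elim id (ih hZE (by omega) (by omega))
    have haT : {a} ∈ T := by
      refine (hT.mem_or_compl_mem {a} (by simpa) ?_).resolve_right (hT.compl_singleton_notMem a haE)
      have := M.conn_singleton_le a
      omega
    refine absurd ?_ (hT.union_ne _ haT _ hZT _ hZc)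
    rw [Set.singleton_union, Set.union_sdiff_cancel hZ]

lemma eRk_tangleMatroid_le (hT : M.IsTangle T θ) (X : Set α) : hT.matroid.eRk X ≤ θ := by
  rw [← eRk_inter_ground, hT.matroid_ground, hT.eRk_matroid Set.inter_subset_right]
  exact_mod_cast hT.tangleRk_le _

lemma indep_tangleMatroid_iff (hT : M.IsTangle T θ) (hX : X ⊆ M.E) :
    hT.matroid.Indep X ↔ X.ncard ≤ M.tangleRk T θ X := by
  rw [indep_iff_eRk_eq_encard, ← (eRk_le_encard _ X).ge_iff_eq, hT.eRk_matroid hX,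
    ← (M.ground_finite.subset hX).cast_ncard_eq, ENat.natCast_le_natCast]

lemma indep_tangleMatroid_of_isKConnected (hT : M.IsTangle T θ) (hM : M.IsKConnected n)
    (hX : X ⊆ M.E) (hXn : X.ncard < n) (hXθ : X.ncard ≤ θ) : hT.matroid.Indep X := by
  rw [indep_tangleMatroid_iff hT hX]
  obtain hrank | ⟨Y, hY, hXY, hrank⟩ := tangleRk_eq_or (M := M) (T := T) (θ := θ) X
  · rwa [hrank]
  rw [← hrank]
  by_contra! hconn
  have hYE := hT.subset_ground Y hY
  obtain hcard | hcard := isKConnected_iff.1 hM _ hXn Y hYE hconn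
  · exact hcard.not_ge (Set.ncard_le_ncard hXY (M.ground_finite.subset hYE))
  · have hYc : M.E \ Y ∈ T := mem_tangle_of_ncard_le hT Set.sdiff_subset (hcard.le.trans hXθ)
      ((conn_compl hYE).trans_lt (hconn.trans_le hXθ))
    exact hT.union_ne Y hY Y hY _ hYc (by rw [Set.union_self, Set.union_sdiff_cancel hYE])

/-- A cocircuit `K` has connectivity less than `|K|`; if `|K| ≤ θ` then it is small enough to lie
in the tangle itself. -/
lemma not_indep_tangleMatroid_of_isCocircuit (hT : M.IsTangle T θ) (hK : M.IsCocircuit K) :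
    ¬ hT.matroid.Indep K := by
  rw [indep_tangleMatroid_iff hT hK.subset_ground, not_le]
  by_contra! hrank
  have hconn := conn_lt_ncard_of_isCocircuit hK
  have hθ := hrank.trans (hT.tangleRk_le K)
  have hKT := mem_tangle_of_ncard_le hT hK.subset_ground hθ (hconn.trans_le hθ)
  exact (hrank.trans (tangleRk_le_conn hKT subset_rfl)).not_gt hconn

lemma disjoint_of_skew_tangleMatroid (hT : M.IsTangle T θ) (hM : M.IsKConnected 2) (hθ : 1 ≤ θ)
    (hX : X ⊆ M.E) (hXY : Skew hT.matroid X Y) : Disjoint X Y := by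
  refine Set.disjoint_left.2 fun x hxX hxY => ?_
  have hx : hT.matroid.Indep {x} := indep_tangleMatroid_of_isKConnected hT hM
    (Set.singleton_subset_iff.2 (hX hxX)) (by simp) (by simpa)
  have hdisj := (hXY.disjoint_and_indep_union hx (by simpa) hx (by simpa)).1
  simp at hdisj

lemma not_isCocircuit_of_skew_tangleMatroid (hT : M.IsTangle T θ) (hM : M.IsKConnected 3)
    (hθ : 2 ≤ θ) (hXY : Skew hT.matroid X Y) (ha : a ∈ X) (hb : b ∈ X) (hc : c ∈ Y) (hd : d ∈ Y) :
    ¬ M.IsCocircuit {a, b, c, d} := by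
  intro hK
  have hpair {x y : α} (hxy : {x, y} ⊆ M.E) : hT.matroid.Indep {x, y} := by
    have hcard := Set.ncard_insert_le x {y}
    rw [Set.ncard_singleton] at hcard
    exact indep_tangleMatroid_of_isKConnected hT hM hxy (by omega) (by omega)
  have hab : {a, b} ⊆ X := Set.pair_subset ha hb
  have hcd : {c, d} ⊆ Y := Set.pair_subset hc hd
  have hunion : ({a, b, c, d} : Set α) = {a, b} ∪ {c, d} := by grind
  have hKE := hK.subset_ground
  rw [hunion, Set.union_subset_iff] at hKE
  refine not_indep_tangleMatroid_of_isCocircuit hT hK ?_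
  rw [hunion]
  exact (hXY.disjoint_and_indep_union (hpair hKE.1) hab (hpair hKE.2) hcd).2

end Tangle

section Fan

variable {α : Type*} {M : Matroid α} {F : List α} {e : α}

lemma isTriangle_or_isTriad_of_isFan (hF : M.IsFan F) (i : ℕ) (hi : i + 2 < F.length) :
    M.IsTriangle {F[i], F[i + 1], F[i + 2]} ∨ M.IsTriad {F[i], F[i + 1], F[i + 2]} := by
  induction i with
  | zero => exact hF.start
  | succ i ih =>
    exact (ih (by omega)).symm.imp (hF.triangle_of_triad i (by omega))
      (hF.triad_of_triangle i (by omega))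

lemma eq_zero_or_succ_eq_length_of_notMem_triad (hF : M.IsFan F) (hlen : 4 ≤ F.length) {j : ℕ}
    (hj : j < F.length) (hnot : ∀ K, M.IsTriad K → F[j] ∉ K) : j = 0 ∨ j + 1 = F.length := by
  by_contra! hend
  obtain ⟨i, hi, hj_eq⟩ : ∃ i, i + 3 < F.length ∧ (j = i + 1 ∨ j = i + 2) :=
    ⟨min (j - 1) (F.length - 4), by omega, by omega⟩
  obtain htriangle | htriad := isTriangle_or_isTriad_of_isFan hF i (by omega)
  · refine hnot _ (hF.triad_of_triangle i hi htriangle) ?_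
    obtain rfl | rfl := hj_eq <;> simp
  · refine hnot _ htriad ?_
    obtain rfl | rfl := hj_eq <;> simp

lemma exists_isTriangle_isTriad_of_isFan (hF : M.IsFan F) (hlen : 4 ≤ F.length) (he : e ∈ F)
    (hnot : ∀ K, M.IsTriad K → e ∉ K) :
    ∃ f ∈ F, ∃ g ∈ F, ∃ h ∈ F, M.IsTriangle {e, f, g} ∧ M.IsTriad {f, g, h} := by
  obtain ⟨j, hj, rfl⟩ := List.getElem_of_mem he
  obtain rfl | hlast := eq_zero_or_succ_eq_length_of_notMem_triad hF hlen hj hnot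
  · have htriangle : M.IsTriangle {F[0], F[1], F[2]} :=
      hF.start.resolve_right fun h => hnot _ h (Set.mem_insert _ _)
    exact ⟨F[1], List.getElem_mem _, F[2], List.getElem_mem _, F[3], List.getElem_mem _,
      htriangle, hF.triad_of_triangle 0 (by omega) htriangle⟩
  · obtain ⟨i, rfl⟩ : ∃ i, j = i + 3 := ⟨j - 3, by omega⟩
    have htriangle : M.IsTriangle {F[i + 1], F[i + 2], F[i + 3]} :=
      (isTriangle_or_isTriad_of_isFan hF (i + 1) (by omega)).resolve_right
        fun h => hnot _ h (by simp)
    have htriad : M.IsTriad {F[i], F[i + 1], F[i + 2]} :=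
      (isTriangle_or_isTriad_of_isFan hF i (by omega)).resolve_left
        fun h => hnot _ (hF.triad_of_triangle i (by omega) h) (by simp)
    refine ⟨F[i + 1], List.getElem_mem _, F[i + 2], List.getElem_mem _, F[i],
      List.getElem_mem _, ?_, ?_⟩
    · rwa [Set.insert_comm, Set.pair_comm]
    · convert htriad using 1
      grind

lemma setOf_mem_eq_ground_of_isFan [M.Finite] (hF : M.IsFan F) (hcard : M.E.ncard ≤ F.length) :
    {x | x ∈ F} = M.E := by
  classical
  rw [← List.coe_toFinset]
  refine Set.eq_of_subset_of_ncard_le (fun x hx => hF.subset_ground x (by simpa using hx)) ?_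
    M.ground_finite
  rwa [Set.ncard_coe_finset, List.toFinset_card_of_nodup hF.nodup]

end Fan

lemma exists_fanSystem {α ι : Type*} {M : Matroid α} [M.Finite] (hM : M.IsKConnected 3)
    (hE : 5 ≤ M.E.ncard) {T : Set (Set α)} {θ : ℕ} (hT : M.IsTangle T θ) (hθ : 2 ≤ θ)
    {F : ι → List α} (hskew : Pairwise fun i j => Skew hT.matroid {x | x ∈ F i} {x | x ∈ F j})
    (hF : ∀ i, M.IsFan (F i)) (hF_len : ∀ i, 4 ≤ (F i).length) {e : ι → α} (he : ∀ i, e i ∈ F i)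
    (he_conn : ∀ i, (M ＼ {e i}).IsKConnected 3) :
    ∃ f g h, FanSystem M e f g h ∧ ∀ i, {e i, f i, g i, h i} ⊆ {x | x ∈ F i} := by
  have hnot (i : ι) (K : Set α) (hK : M.IsTriad K) : e i ∉ K := by
    have hcard : K.ncard = 3 := by rw [Set.ncard_def, hK.2]; rfl
    have hnontrivial : K.Nontrivial :=
      (Set.one_lt_ncard (M.ground_finite.subset hK.1.subset_ground)).1 (by omega)
    exact notMem_of_isCocircuit_of_isKConnected_delete (he_conn i) hK.1 hnontrivial hcard.le
      (by omega)
  choose f hf g hg h hh htriangle htriad using fun i =>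
    exists_isTriangle_isTriad_of_isFan (hF i) (hF_len i) (he i) (hnot i)
  have hsub (i : ι) : {e i, f i, g i, h i} ⊆ {x | x ∈ F i} := by
    rintro x (rfl | rfl | rfl | rfl)
    exacts [he i, hf i, hg i, hh i]
  have hpair (i : ι) : {f i, g i} ⊆ {x | x ∈ F i} := Set.pair_subset (hf i) (hg i)
  refine ⟨f, g, h, ⟨htriangle, htriad, fun i j hij => ?_, fun i K => hnot i K,
    fun {i j} hij x y hx hy => ?_⟩, hsub⟩
  · have hdisj := disjoint_of_skew_tangleMatroid hT (fun k hk => hM k (by omega)) (by omega)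
      (hF i).subset_ground (hskew hij)
    exact hdisj.mono (hsub i) (hsub j)
  · exact not_isCocircuit_of_skew_tangleMatroid hT hM hθ (hskew hij) (he i) (hpair i hx) (he j)
      (hpair j hy)

lemma subsingleton_of_pairwise_skew_of_eq_ground {α ι : Type*} {M : Matroid α} [M.Finite]
    (hM : M.IsKConnected 2) (hE : M.E.Nonempty) {T : Set (Set α)} {θ : ℕ} (hT : M.IsTangle T θ)
    (hθ : 1 ≤ θ) {X : ι → Set α} (hX : ∀ i, X i = M.E)
    (hskew : Pairwise fun i j => Skew hT.matroid (X i) (X j)) : Subsingleton ι := by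
  refine ⟨fun i j => by_contra fun hij => hE.ne_empty (disjoint_self.1 ?_)⟩
  have hdisj := disjoint_of_skew_tangleMatroid hT hM hθ (hX i).subset (hskew hij)
  rwa [hX i, hX j] at hdisj

end TangleFans

theorem mainTheorem8_general {α ι : Type*} [Finite ι] {M N : Matroid α} [M.Finite]
    (hM : M.IsKConnected 3) {T : Set (Set α)} {θ : ℕ} (hT : M.IsTangle T θ) (hN : N ≤m M)
    {X : ι → Set α} (hX : ∀ i, 2 ≤ hT.matroid.eRk (X i))
    (hskew : Pairwise fun i j => TangleFans.Skew hT.matroid (X i) (X j))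
    (h_disj : ∀ i, X i ∩ N.E = ∅) {F : ι → List α} (hF : ∀ i, M.IsFan (F i))
    (hFX : ∀ i, ∀ x ∈ F i, x ∈ X i) (hF_len : ∀ i, 4 ≤ (F i).length)
    {e : ι → α} (he : ∀ i, e i ∈ F i) (he_conn : ∀ i, (M ＼ {e i}).IsKConnected 3) :
    (M ＼ Set.range e).IsKConnected 3 ∧ N ≤m M ＼ Set.range e := by
  obtain hι | ⟨⟨i⟩⟩ := isEmpty_or_nonempty ι
  · rw [Set.range_eq_empty, Matroid.delete_empty]
    exact ⟨hM, hN⟩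
  have hθ : 2 ≤ θ := by exact_mod_cast (hX i).trans (TangleFans.eRk_tangleMatroid_le hT (X i))
  have hskew_fan : Pairwise fun i j =>
      TangleFans.Skew hT.matroid {x | x ∈ F i} {x | x ∈ F j} :=
    fun i j hij => (hskew hij).mono (hFX i) (hFX j)
  have hdisj_fan (i : ι) : Disjoint {x | x ∈ F i} N.E :=
    (Set.disjoint_iff_inter_eq_empty.2 (h_disj i)).mono_left (hFX i)
  obtain hE | hE := le_or_gt 5 M.E.ncard
  · obtain ⟨f, g, h, H, hsub⟩ :=
      TangleFans.exists_fanSystem hM hE hT hθ hskew_fan hF hF_len he he_conn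
    exact ⟨H.isKConnected_delete hM (by omega),
      H.isMinor_delete hM (by omega) hN fun i => (hdisj_fan i).mono_left (hsub i)⟩
  · have hground (j : ι) : {x | x ∈ F j} = M.E :=
      TangleFans.setOf_mem_eq_ground_of_isFan (hF j) (by have := hF_len j; omega)
    have := TangleFans.subsingleton_of_pairwise_skew_of_eq_ground (fun k hk => hM k (by omega))
      ⟨e i, (hF i).subset_ground _ (he i)⟩ hT (by omega) hground hskew_fan
    have hrange : Set.range e = {e i} := by
      simpa [Set.range_eq_iff] using fun j => congrArg e (Subsingleton.elim j i)
    have hN_empty : N.E = ∅ := disjoint_self.1 ((hdisj_fan i).mono_left (hground i ▸ hN.subset))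
    exact ⟨hrange ▸ he_conn i, TangleFans.isMinor_of_ground_eq_empty hN_empty⟩

theorem mainTheorem8 {α : Type*} (M N : Matroid α) [M.Finite] (hM : M.IsKConnected 3)
    (T : Set (Set α)) (θ : ℕ) (hT : M.IsTangle T θ) (hN : N ≤m M)
    (r : ℕ) (X : Fin r → Set α)
    (hX : ∀ i, hT.matroid.IsLongLine (X i))
    (h_rank : hT.matroid.eRk (⋃ i, X i) = ((2 * r : ℕ) : ℕ∞))
    (h_disj : ∀ i, X i ∩ N.E = ∅)
    (F : Fin r → List α)
    (hF : ∀ i, M.IsMaximalFan (F i))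
    (hFX : ∀ i, ∀ x ∈ F i, x ∈ X i)
    (hF_len : ∀ i, 4 ≤ (F i).length)
    (e : Fin r → α) (he : ∀ i, e i ∈ F i)
    (he_conn : ∀ i, (M ＼ {e i}).IsKConnected 3)
    (he_minor : ∀ i, N ≤m M ＼ {e i}) :
    (M ＼ Set.range e).IsKConnected 3 ∧ N ≤m M ＼ Set.range e :=
  mainTheorem8_general hM hT hN (fun i => (hX i).rank_eq.ge)
    (TangleFans.pairwise_skew_of_sum_eRk_le (by simp [h_rank, (hX _).rank_eq, mul_comm]))
    h_disj (fun i => (hF i).1) hFX hF_len he he_conn
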